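/- Let $\mathcal H$ be a complex separable (possibly finite-dimensional) Hilbert space with an orthonormal basis $(e_i)$, and let $\mu$ be a finite positive Borel measure on $[0,1]$. Let $\mathcal T(\mathcal H)_{sa}$ be the set of self-adjoint trace-class operators on $\mathcal H$ and $\mathcal S(\mathcal H)$ the set of states (positive trace-class operators of trace one). For $f:[0,1]\to\mathcal B(\mathcal H)$ and a trace-class operator $t$ put $f_t(x)=\operatorname{tr}(t f(x))$ and $f_{ij}(x)=\langle f(x)e_j,e_i\rangle$. Let $L^1_{\mathcal H}([0,1],\mu I)$ be the complex linear span of the functions $f:[0,1]\to\mathcal B(\mathcal H)$ with $f(x)\ge 0$ for all $x$ for which $f_s$ is Borel measurable and $\mu$-integrable for every $s\in\mathcal S(\mathcal H)$, where functions that agree $\mu$-almost everywhere are identified. For real-valued $u,v\in L^1([0,1],\mu)$ and $a=\mu([0,1])$ write $u\prec v$ if $\int_0^r u^\downarrow\,dx\le\int_0^r v^\downarrow\,dx$ for all $0\le r\le a$, with equality for $r=a$, where $u^\downarrow(r)=\sup\{c:\mu(\{u>c\})\ge r\}$. A linear operator $B$ on the complex space $L^1([0,1],\mu)$ is bistochastic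 if it is positive, $\int Bh\,d\mu=\int h\,d\mu$ for all $h$, and $B1=1$; it acts on operator-valued functions entrywise, so that $Bg=f$ means $B(g_{ij})=f_{ij}$ in $L^1([0,1],\mu)$ for all $i,j$. For self-adjoint $f,g\in L^1_{\mathcal H}([0,1],\mu I)$ write - $f\prec g$ if there is a bistochastic operator $B$ on $L^1([0,1],\mu)$ with $Bg=f$; - $f\prec_T g$ if $f_t\prec g_t$ for all $t\in\mathcal T(\mathcal H)_{sa}$; - $f\prec_S g$ if $f_s\prec g_s$ for all $s\in\mathcal S(\mathcal H)$. Then for all self-adjoint $f,g\in L^1_{\mathcal H}([0,1],\mu I)$, $$f\prec g\ \Longrightarrow\ f\prec_T g\ \Longrightarrow\ f\prec_S g .$$ -/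

import Mathlib

open MeasureTheory Set
open scoped ComplexOrder InnerProductSpace

namespace QRV

noncomputable section

/-! ### Trace, trace-class operators, states

`b` is an orthonormal basis of the Hilbert space `H`, in which traces are computed. -/

section Operators

variable {ι : Type*} {H : Type*} [NormedAddCommGroup H] [InnerProductSpace ℂ H] [CompleteSpace H]

/-- The trace of `T`. -/
def trace (b : HilbertBasis ι ℂ H) (T : H →L[ℂ] H) : ℂ :=
  ∑' i, ⟪b i, T (b i)⟫_ℂ

/-- `T` is of trace class: `tr √(T* T) < ∞`. -/
def IsTraceClass (b : HilbertBasis ι ℂ H) (T : H →L[ℂ] H) : Prop :=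
  Summable fun i => ⟪b i, (CFC.abs T) (b i)⟫_ℂ

/-- `s` is a state (density operator): a positive trace-class operator of trace one. -/
def IsState (b : HilbertBasis ι ℂ H) (s : H →L[ℂ] H) : Prop :=
  IsTraceClass b s ∧ s.IsPositive ∧ trace b s = 1

end Operators

/-! ### Quantum random variables and the space of integrable ones -/

section Integrable

variable {ι : Type*} {H : Type*} [NormedAddCommGroup H] [InnerProductSpace ℂ H] [CompleteSpace H]
variable {X : Type*} [MeasurableSpace X]

/-- The scalar function `f_t`, that is `x ↦ tr (t f(x))`. -/
def slice (b : HilbertBasis ι ℂ H) (t : H →L[ℂ] H) (f : X → H →L[ℂ] H) (x : X) : ℂ :=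
  trace b (t * f x)

/-- A quantum random variable: `x ↦ tr (s f(x))` is measurable for every state `s`. -/
def IsQRV (b : HilbertBasis ι ℂ H) (f : X → H →L[ℂ] H) : Prop :=
  ∀ s : H →L[ℂ] H, IsState b s → Measurable (slice b s f)

/-- A positive quantum random variable that is integrable against the operator-valued measure
`μ I_H`. (For `ν = μ I_H` one has `ν_ρ = μ` and `dν/dν_ρ = I_H` for every state `ρ`, so that
`ν`-integrability is the `μ`-integrability of `x ↦ tr (s f(x))` for every state `s`.) -/
def IsPositiveIntegrable (b : HilbertBasis ι ℂ H) (μ : Measure X) (f : X → H →L[ℂ] H) : Prop :=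
  IsQRV b f ∧ (∀ x, (f x).IsPositive) ∧
    ∀ s : H →L[ℂ] H, IsState b s → Integrable (slice b s f) μ

/-- The space `𝓛¹_H(X, μ I_H)`: the complex span of the positive integrable quantum random
variables. Its elements are the representatives of the elements of `L¹_H(X, μ I_H)`. -/
def calL1 (b : HilbertBasis ι ℂ H) (μ : Measure X) : Submodule ℂ (X → H →L[ℂ] H) :=
  Submodule.span ℂ {f | IsPositiveIntegrable b μ f}

end Integrable

/-! ### Classical majorization and classical bistochastic operators -/

section Classical

variable {X : Type*} [MeasurableSpace X]

/-- The distribution function `d_f(s) = μ {x | f x > s}`. -/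
def distrib (μ : Measure X) (f : X → ℝ) (s : ℝ) : ℝ :=
  μ.real {x | s < f x}

/-- The decreasing rearrangement `f↓(t) = sup {s | d_f(s) ≥ t}`. For integrable `f` on a finite
measure space the supremum is that of a nonempty bounded set whenever `0 < t < μ(X)`. -/
def rearrange (μ : Measure X) (f : X → ℝ) (t : ℝ) : ℝ :=
  sSup {s | t ≤ distrib μ f s}

/-- Classical majorization `f ≺ g` of functions in `L¹(X, μ)`, for a finite measure `μ`. -/
def Majorized (μ : Measure X) (f g : X → ℝ) : Prop :=
  Integrable f μ ∧ Integrable g μ ∧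
    (∀ t ∈ Icc (0 : ℝ) (μ.real univ),
      ∫ r in (0 : ℝ)..t, rearrange μ f r ≤ ∫ r in (0 : ℝ)..t, rearrange μ g r) ∧
    ∫ r in (0 : ℝ)..(μ.real univ), rearrange μ g r =
      ∫ r in (0 : ℝ)..(μ.real univ), rearrange μ f r

/-- `B` is a bistochastic operator on the classical (complex) space `L¹(X, μ)`: it is positive,
preserves the integral, and fixes the constant function `1`. -/
structure IsBistochastic (μ : Measure X) [IsFiniteMeasure μ]
    (B : Lp ℂ 1 μ →ₗ[ℂ] Lp ℂ 1 μ) : Prop where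
  positive : ∀ h : Lp ℂ 1 μ, (∀ᵐ x ∂μ, 0 ≤ h x) → ∀ᵐ x ∂μ, 0 ≤ B h x
  integral_eq : ∀ h : Lp ℂ 1 μ, ∫ x, B h x ∂μ = ∫ x, h x ∂μ
  map_one : B (Lp.const 1 μ (1 : ℂ)) = Lp.const 1 μ (1 : ℂ)

end Classical

/-! ### The three majorization relations for self-adjoint quantum random variables -/

section Relations

variable {ι : Type*} {H : Type*} [NormedAddCommGroup H] [InnerProductSpace ℂ H] [CompleteSpace H]
variable {X : Type*} [MeasurableSpace X]

/-- The matrix entry `f_{ij}(x) = ⟨f(x) e_j, e_i⟩`. -/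
def entry (b : HilbertBasis ι ℂ H) (f : X → H →L[ℂ] H) (i j : ι) (x : X) : ℂ :=
  ⟪b i, f x (b j)⟫_ℂ

/-- `B g = f`, where the classical operator `B` acts on operator-valued functions entrywise,
`B [g_{ij}] = [B g_{ij}]`: for all `i`, `j` the entries `g_{ij}`, `f_{ij}` are in `L¹(X, μ)`
and `B g_{ij} = f_{ij}` there. -/
def EntrywiseMaps (b : HilbertBasis ι ℂ H) (μ : Measure X) (B : Lp ℂ 1 μ →ₗ[ℂ] Lp ℂ 1 μ)
    (g f : X → H →L[ℂ] H) : Prop :=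
  ∀ i j, ∃ (hg : Integrable (entry b g i j) μ) (hf : Integrable (entry b f i j) μ),
    B (hg.toL1 (entry b g i j)) = hf.toL1 (entry b f i j)

/-- `f ≺ g`: there is a bistochastic operator `B` on `L¹(X, μ)` with `B g = f`. -/
def Prec (b : HilbertBasis ι ℂ H) (μ : Measure X) [IsFiniteMeasure μ]
    (f g : X → H →L[ℂ] H) : Prop :=
  ∃ B : Lp ℂ 1 μ →ₗ[ℂ] Lp ℂ 1 μ, IsBistochastic μ B ∧ EntrywiseMaps b μ B g f

/-- `f ≺_T g`: `f_t ≺ g_t` for every self-adjoint trace-class operator `t`. For self-adjoint `f`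
and `t` the number `tr (t f(x))` is real, so `re` only changes its type. -/
def PrecT (b : HilbertBasis ι ℂ H) (μ : Measure X) (f g : X → H →L[ℂ] H) : Prop :=
  ∀ t : H →L[ℂ] H, IsTraceClass b t → IsSelfAdjoint t →
    Majorized μ (fun x => (slice b t f x).re) (fun x => (slice b t g x).re)

/-- `f ≺_S g`: `f_s ≺ g_s` for every state `s`. -/
def PrecS (b : HilbertBasis ι ℂ H) (μ : Measure X) (f g : X → H →L[ℂ] H) : Prop :=
  ∀ s : H →L[ℂ] H, IsState b s →
    Majorized μ (fun x => (slice b s f x).re) (fun x => (slice b s g x).re)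

end Relations

end

end QRV

/-!
Every state is a self-adjoint trace-class operator, so `f ≺_T g` restricts to `f ≺_S g`. The content
is the passage from a bistochastic `B` with `B g_{ij} = f_{ij}` to `f_t ≺ g_t` for every self-adjoint
trace-class `t`. It rests on two facts.

*The operator `B` maps `g_t` to `f_t`.* A bistochastic operator is isometric on positive functions,
hence bounded on `L¹` (`IsBistochastic.norm_map_le`). On the other side, every matrix coefficient
`x ↦ ⟨u, f(x) v⟩` of an integrable `f` is integrable, since rank-one projections are states, and the
closed graph theorem with the uniform boundedness principle makes `(u, v) ↦ ⟨u, f(·) v⟩` a bounded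
sesquilinear map into `L¹` (`exists_sesquilinear_toL1`). By density `B` maps the coefficients
of `g` to those of `f` at all pairs of vectors, not only at basis vectors (`map_coefficient_eq`).
Writing `t = S² - R²` with self-adjoint Hilbert–Schmidt operators `S` and `R`, cyclicity of the trace
gives `f_t = ∑ᵢ ⟨S eᵢ, f(·) S eᵢ⟩ - ∑ᵢ ⟨R eᵢ, f(·) R eᵢ⟩`. Both series converge absolutely in `L¹`
because `∑ᵢ ‖S eᵢ‖²` and `∑ᵢ ‖R eᵢ‖²` are finite (`exists_hasSum_slice_sq`), and so `B` can be
applied term by term.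

*A bistochastic operator decreases in the majorization order.* Equimeasurability of a function and
its decreasing rearrangement (`identDistrib_rearrange`) yields
`∫₀ᵗ w↓ = min_c (t c + ∫ (w - c)⁺ dμ)`, with the minimum attained at `c = w↓(t)`. It therefore
suffices that `∫ (B w - c)⁺ ≤ ∫ (w - c)⁺` for all `c`, and this follows from positivity of `B`,
`B 1 = 1` and preservation of the integral (`IsBistochastic.integral_posPart_re_le`).
-/

namespace QRV

/-! ### Trace-class operators as squares of Hilbert–Schmidt operators -/

section HilbertSchmidt

variable {ι : Type*} {H : Type*} [NormedAddCommGroup H] [InnerProductSpace ℂ H]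

lemma hasSum_norm_inner_sq (b : HilbertBasis ι ℂ H) (v : H) :
    HasSum (fun i => ‖⟪b i, v⟫_ℂ‖ ^ 2) (‖v‖ ^ 2) := by
  have h := Complex.hasSum_re (b.hasSum_inner_mul_inner v v)
  convert! h using 1
  · funext i
    rw [← inner_conj_symm v, Complex.conj_mul', ← Complex.ofReal_pow, Complex.ofReal_re]
  · rw [inner_self_eq_norm_sq_to_K]
    norm_cast

lemma re_inner_self_nonneg {t : H →L[ℂ] H} (ht : 0 ≤ t) (v : H) : 0 ≤ (⟪v, t v⟫_ℂ).re :=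
  (((ContinuousLinearMap.nonneg_iff_isPositive t).1 ht).inner_nonneg_right v).1

variable [CompleteSpace H]

/-- Cyclicity of the trace in the form `tr (S² A) = tr (S A S)`, for a self-adjoint
Hilbert–Schmidt operator `S` and a bounded operator `A`. -/
lemma hasSum_trace_sq_mul (b : HilbertBasis ι ℂ H) {S : H →L[ℂ] H} (hS : IsSelfAdjoint S)
    (hsum : Summable fun i => ‖S (b i)‖ ^ 2) (A : H →L[ℂ] H) :
    ∃ τ, HasSum (fun i => ⟪b i, (S * S * A) (b i)⟫_ℂ) τ ∧
      HasSum (fun i => ⟪S (b i), A (S (b i))⟫_ℂ) τ := by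
  have hsymm (u v : H) : ⟪S u, v⟫_ℂ = ⟪u, S v⟫_ℂ := by
    rw [← ContinuousLinearMap.adjoint_inner_right, hS.adjoint_eq]
  -- the double series obtained by inserting the resolution of the identity between `S` and `S A`
  set F : ι × ι → ℂ := fun p => ⟪S (b p.2), b p.1⟫_ℂ * ⟪b p.1, S (A (b p.2))⟫_ℂ with hF
  have hF' (p : ι × ι) :
      F p = ⟪ContinuousLinearMap.adjoint A (S (b p.1)), b p.2⟫_ℂ * ⟪b p.2, S (b p.1)⟫_ℂ := by
    simp only [hF, hsymm (b p.2), ContinuousLinearMap.adjoint_inner_left, hsymm (b p.1)]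
    ring
  have hsummable (T : H →L[ℂ] H) :
      Summable fun p : ι × ι => ‖⟪b p.2, T (S (b p.1))⟫_ℂ‖ ^ 2 := by
    refine (summable_prod_of_nonneg
      (f := fun p : ι × ι => ‖⟪b p.2, T (S (b p.1))⟫_ℂ‖ ^ 2) fun p => sq_nonneg _).2
      ⟨fun k => (hasSum_norm_inner_sq b (T (S (b k)))).summable, ?_⟩
    simp only [(hasSum_norm_inner_sq b (T (S (b _)))).tsum_eq]
    refine Summable.of_nonneg_of_le (fun _ => by positivity) (fun k => ?_)
      (hsum.mul_left (‖T‖ ^ 2))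
    rw [← mul_pow]
    gcongr
    exact T.le_opNorm _
  have hFs : Summable F := by
    refine Summable.of_norm_bounded ((hsummable (ContinuousLinearMap.adjoint A)).add
      (hsummable 1)) fun p => ?_
    rw [hF', norm_mul, ← norm_inner_symm, one_apply_eq_self]
    nlinarith [sq_nonneg (‖⟪b p.2, ContinuousLinearMap.adjoint A (S (b p.1))⟫_ℂ‖ -
      ‖⟪b p.2, S (b p.1)⟫_ℂ‖), sq_nonneg ‖⟪b p.2, S (b p.1)⟫_ℂ‖,
      sq_nonneg ‖⟪b p.2, ContinuousLinearMap.adjoint A (S (b p.1))⟫_ℂ‖]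
  refine ⟨∑' p, F p, ?_, ?_⟩
  · refine ((Equiv.prodComm ι ι).hasSum_iff.2 hFs.hasSum).prod_fiberwise fun i => ?_
    have h := b.hasSum_inner_mul_inner (S (b i)) (S (A (b i)))
    rw [hsymm] at h
    exact h
  · refine hFs.hasSum.prod_fiberwise fun k => ?_
    simp only [hF']
    have h := b.hasSum_inner_mul_inner (ContinuousLinearMap.adjoint A (S (b k))) (S (b k))
    rwa [ContinuousLinearMap.adjoint_inner_left] at h

/-- The square root of a positive operator with summable diagonal is Hilbert–Schmidt. -/
lemma exists_sq_eq_of_nonneg (b : HilbertBasis ι ℂ H) {t : H →L[ℂ] H} (ht : 0 ≤ t)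
    (hsum : Summable fun i => (⟪b i, t (b i)⟫_ℂ).re) :
    ∃ S : H →L[ℂ] H, IsSelfAdjoint S ∧ (Summable fun i => ‖S (b i)‖ ^ 2) ∧ S * S = t := by
  have hsa : IsSelfAdjoint (CFC.sqrt t) := (CFC.sqrt_nonneg t).isSelfAdjoint
  refine ⟨CFC.sqrt t, hsa, ?_, CFC.sqrt_mul_sqrt_self t ht⟩
  convert! hsum using 2 with i
  conv_rhs => rw [← CFC.sqrt_mul_sqrt_self t ht]
  rw [mul_apply_eq_comp, ← ContinuousLinearMap.adjoint_inner_left, hsa.adjoint_eq,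
    inner_self_eq_norm_sq_to_K]
  norm_cast

/-- A self-adjoint trace-class operator is a difference of squares of self-adjoint
Hilbert–Schmidt operators, namely of the square roots of its positive and negative parts. -/
lemma exists_sq_sub_sq (b : HilbertBasis ι ℂ H) {t : H →L[ℂ] H} (ht : IsTraceClass b t)
    (hsa : IsSelfAdjoint t) :
    ∃ S R : H →L[ℂ] H, IsSelfAdjoint S ∧ (Summable fun i => ‖S (b i)‖ ^ 2) ∧
      IsSelfAdjoint R ∧ (Summable fun i => ‖R (b i)‖ ^ 2) ∧ t = S * S - R * R := by
  have habs : Summable fun i => (⟪b i, (CFC.abs t) (b i)⟫_ℂ).re :=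
    (Complex.hasSum_re ht.hasSum).summable
  have hadd (i : ι) : (⟪b i, (CFC.abs t) (b i)⟫_ℂ).re =
      (⟪b i, t⁺ (b i)⟫_ℂ).re + (⟪b i, t⁻ (b i)⟫_ℂ).re := by
    rw [← CFC.posPart_add_negPart t hsa, add_apply, inner_add_right,
      Complex.add_re]
  have hp := CFC.posPart_nonneg t
  have hn := CFC.negPart_nonneg t
  obtain ⟨S, hS, hSs, hSt⟩ := exists_sq_eq_of_nonneg b hp <|
    habs.of_nonneg_of_le (fun i => re_inner_self_nonneg hp _) fun i => by
      rw [hadd]; linarith [re_inner_self_nonneg hn (b i)]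
  obtain ⟨R, hR, hRs, hRt⟩ := exists_sq_eq_of_nonneg b hn <|
    habs.of_nonneg_of_le (fun i => re_inner_self_nonneg hn _) fun i => by
      rw [hadd]; linarith [re_inner_self_nonneg hp (b i)]
  exact ⟨S, R, hS, hSs, hR, hRs, by rw [hSt, hRt, CFC.posPart_sub_negPart t hsa]⟩

/-- The rank-one projection onto the line of a unit vector is a state. -/
lemma isState_rankOne (b : HilbertBasis ι ℂ H) {v : H} (hv : ‖v‖ = 1) :
    IsState b (InnerProductSpace.rankOne ℂ v v) := by
  have hpos := InnerProductSpace.isPositive_rankOne_self (𝕜 := ℂ) v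
  have hsum : HasSum (fun i => ⟪b i, InnerProductSpace.rankOne ℂ v v (b i)⟫_ℂ) 1 := by
    convert! b.hasSum_inner_mul_inner v v using 1
    · funext i
      rw [InnerProductSpace.rankOne_apply, inner_smul_right]
    · rw [inner_self_eq_norm_sq_to_K, hv]; simp
  refine ⟨?_, hpos, hsum.tsum_eq⟩
  rw [IsTraceClass, CFC.abs_of_nonneg _ ((ContinuousLinearMap.nonneg_iff_isPositive _).2 hpos)]
  exact hsum.summable

lemma slice_rankOne {X : Type*} (b : HilbertBasis ι ℂ H) (v : H) (f : X → H →L[ℂ] H) (x : X) :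
    slice b (InnerProductSpace.rankOne ℂ v v) f x = ⟪v, f x v⟫_ℂ := by
  have h := b.hasSum_inner_mul_inner (ContinuousLinearMap.adjoint (f x) v) v
  rw [ContinuousLinearMap.adjoint_inner_left] at h
  refine (HasSum.tsum_eq ?_)
  convert! h using 1
  funext i
  rw [mul_apply_eq_comp, InnerProductSpace.rankOne_apply, inner_smul_right,
    ContinuousLinearMap.adjoint_inner_left]

end HilbertSchmidt

/-! ### Matrix coefficients as elements of `L¹` -/

section Coefficients

open Filter Topology

variable {X : Type*} [MeasurableSpace X] {μ : Measure X}

/-- An `L¹` limit agrees almost everywhere with a pointwise limit. -/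
lemma coeFn_ae_eq_of_tendsto {κ : Type*} [Countable κ] {l : Filter κ} [l.NeBot]
    [l.IsCountablyGenerated] {F : κ → Lp ℂ 1 μ} {G : Lp ℂ 1 μ} {φ : κ → X → ℂ} {ψ : X → ℂ}
    (hF : Tendsto F l (𝓝 G)) (hφ : ∀ k, F k =ᵐ[μ] φ k)
    (hψ : ∀ x, Tendsto (fun k => φ k x) l (𝓝 (ψ x))) : G =ᵐ[μ] ψ := by
  obtain ⟨ns, hns, hlim⟩ := (tendstoInMeasure_of_tendsto_Lp hF).exists_seq_tendsto_ae'
  filter_upwards [hlim, ae_all_iff.2 hφ] with x hx hx'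
  refine tendsto_nhds_unique hx ?_
  simp only [hx']
  exact (hψ x).comp hns

lemma countable_hilbertBasis_index {ι H : Type*} [NormedAddCommGroup H] [InnerProductSpace ℂ H]
    [TopologicalSpace.SeparableSpace H] (b : HilbertBasis ι ℂ H) : Countable ι := by
  refine Pairwise.countable_of_isOpen_disjoint (s := fun i => Metric.ball (b i) (1 / 2))
    (fun i j hij => ?_) (fun _ => Metric.isOpen_ball) fun i => ⟨b i, by simp⟩
  refine Metric.ball_disjoint_ball ?_
  have h : ‖b i - b j‖ ^ 2 = 2 := by
    rw [@norm_sub_sq ℂ, b.orthonormal.1, b.orthonormal.1, b.orthonormal.2 hij]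
    norm_num
  rw [dist_eq_norm]
  nlinarith [norm_nonneg (b i - b j)]

variable {ι : Type*} {H : Type*} [NormedAddCommGroup H] [InnerProductSpace ℂ H] [CompleteSpace H]

/-- A family of functionals all of whose values are integrable depends continuously, as an element
of `L¹`, on the vector. The graph is closed, because `L¹` limits are almost everywhere limits of
subsequences. -/
lemma exists_continuousLinearMap_toL1 (φ : X → H →L[ℂ] ℂ)
    (hφ : ∀ v, Integrable (fun x => φ x v) μ) :
    ∃ L : H →L[ℂ] Lp ℂ 1 μ, ∀ v, L v = (hφ v).toL1 (fun x => φ x v) := by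
  let L : H →ₗ[ℂ] Lp ℂ 1 μ :=
    { toFun := fun v => (hφ v).toL1 (fun x => φ x v)
      map_add' := fun v w => by
        rw [← Integrable.toL1_add, Integrable.toL1_eq_toL1_iff]
        exact ae_of_all _ fun x => (φ x).map_add v w
      map_smul' := fun c v => by
        rw [RingHom.id_apply, ← Integrable.toL1_smul, Integrable.toL1_eq_toL1_iff]
        exact ae_of_all _ fun x => (φ x).map_smul c v }
  refine ⟨⟨L, L.continuous_of_seq_closed_graph fun u v G hu hG => ?_⟩, fun v => rfl⟩
  refine Lp.ext ((coeFn_ae_eq_of_tendsto hG (fun n => (hφ (u n)).coeFn_toL1)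
    fun x => ?_).trans (hφ v).coeFn_toL1.symm)
  exact ((φ x).continuous.tendsto v).comp hu

/-- If all matrix coefficients `x ↦ ⟨u, f(x) v⟩` are integrable, they form a bounded sesquilinear
map into `L¹`: separate continuity is the closed graph theorem, and joint boundedness follows from
the uniform boundedness principle. -/
lemma exists_sesquilinear_toL1 (f : X → H →L[ℂ] H)
    (hf : ∀ u v, Integrable (fun x => ⟪u, f x v⟫_ℂ) μ) :
    ∃ Φ : H →L⋆[ℂ] H →L[ℂ] Lp ℂ 1 μ,
      ∀ u v, Φ u v = (hf u v).toL1 (fun x => ⟪u, f x v⟫_ℂ) := by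
  choose L hL using fun u =>
    exists_continuousLinearMap_toL1 (fun x => innerSL ℂ u ∘L f x) (hf u)
  replace hL : ∀ u v, L u v = (hf u v).toL1 (fun x => ⟪u, f x v⟫_ℂ) := hL
  -- `⟨u, f(x) v⟩` is conjugate linear in `u`; its conjugate is linear and has the same norm
  have hf' (v u : H) : Integrable (fun x => innerSL ℂ (f x v) u) μ := by
    refine ((Complex.conjCLE : ℂ →L[ℝ] ℂ).integrable_comp (hf u v)).congr (ae_of_all _ fun x => ?_)
    exact inner_conj_symm _ _
  choose K hK using fun v => exists_continuousLinearMap_toL1 (fun x => innerSL ℂ (f x v)) (hf' v)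
  have hLK (u v : H) : ‖L u v‖ = ‖K v u‖ := by
    rw [hL, hK, L1.norm_eq_integral_norm, L1.norm_eq_integral_norm]
    refine integral_congr_ae ?_
    filter_upwards [(hf u v).coeFn_toL1, (hf' v u).coeFn_toL1] with x h1 h2
    rw [h2, innerSL_apply_apply, norm_inner_symm, ← h1]
  -- normalizing the index `u` makes the family pointwise bounded, by `‖K v‖` at `v`
  obtain ⟨C, hC⟩ := banach_steinhaus (g := fun u : H => ((‖u‖⁻¹ : ℝ) : ℂ) • L u) fun v => by
    refine ⟨‖K v‖, fun u => ?_⟩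
    rw [smul_apply, norm_smul, hLK, Complex.norm_real, norm_inv, norm_norm]
    rcases eq_or_ne u 0 with rfl | hu
    · simp
    rw [inv_mul_le_iff₀ (norm_pos_iff.2 hu), mul_comm]
    exact (K v).le_opNorm u
  have hbound (u v : H) : ‖L u v‖ ≤ C * ‖u‖ * ‖v‖ := by
    rcases eq_or_ne u 0 with rfl | hu
    · rw [hLK]; simp
    have h := ContinuousLinearMap.le_of_opNorm_le _ (hC u) v
    rw [smul_apply, norm_smul, Complex.norm_real, norm_inv, norm_norm,
      inv_mul_le_iff₀ (norm_pos_iff.2 hu)] at h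
    linarith
  have hadd (u₁ u₂ v : H) : L (u₁ + u₂) v = L u₁ v + L u₂ v := by
    rw [hL, hL, hL, ← Integrable.toL1_add, Integrable.toL1_eq_toL1_iff]
    exact ae_of_all _ fun x => inner_add_left _ _ _
  have hsmul (c : ℂ) (u v : H) : L (c • u) v = (starRingEnd ℂ) c • L u v := by
    rw [hL, hL, ← Integrable.toL1_smul, Integrable.toL1_eq_toL1_iff]
    exact ae_of_all _ fun x => inner_smul_left _ _ _
  exact ⟨(LinearMap.mk₂'ₛₗ (starRingEnd ℂ) (RingHom.id ℂ) (fun u v => L u v) hadd hsmul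
    (fun u => (L u).map_add) (fun c u v => (L u).map_smul c v)).mkContinuous₂ C hbound,
    fun u v => hL u v⟩

/-- For a Hilbert–Schmidt operator `S`, the scalar function `f_{S²}` is the sum in `L¹` of the
matrix coefficients of `f` at the vectors `S e_i`. -/
lemma exists_hasSum_slice_sq [TopologicalSpace.SeparableSpace H] (b : HilbertBasis ι ℂ H)
    {f : X → H →L[ℂ] H} {hf : ∀ u v, Integrable (fun x => ⟪u, f x v⟫_ℂ) μ}
    {Φ : H →L⋆[ℂ] H →L[ℂ] Lp ℂ 1 μ}
    (hΦ : ∀ u v, Φ u v = (hf u v).toL1 (fun x => ⟪u, f x v⟫_ℂ))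
    {S : H →L[ℂ] H} (hS : IsSelfAdjoint S) (hsum : Summable fun i => ‖S (b i)‖ ^ 2) :
    ∃ G : Lp ℂ 1 μ, HasSum (fun i => Φ (S (b i)) (S (b i))) G ∧ G =ᵐ[μ] slice b (S * S) f := by
  have hs : Summable fun i => Φ (S (b i)) (S (b i)) := by
    refine Summable.of_norm_bounded (hsum.mul_left ‖Φ‖) fun i => ?_
    rw [sq, ← mul_assoc]
    exact Φ.le_opNorm₂ _ _
  have := countable_hilbertBasis_index b
  refine ⟨_, hs.hasSum, coeFn_ae_eq_of_tendsto
    (φ := fun s x => ∑ i ∈ s, ⟪S (b i), f x (S (b i))⟫_ℂ) hs.hasSum (fun s => ?_) fun x => ?_⟩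
  · refine (Lp.coeFn_fun_finsetSum s _).trans ?_
    filter_upwards [ae_all_iff.2 fun i => (hf (S (b i)) (S (b i))).coeFn_toL1] with x hx
    refine Finset.sum_congr rfl fun i _ => ?_
    rw [hΦ, hx]
  · obtain ⟨τ, h1, h2⟩ := hasSum_trace_sq_mul b hS hsum (f x)
    have h : slice b (S * S) f x = τ := h1.tsum_eq
    rw [h]
    exact h2

/-- All matrix coefficients of a function in `𝓛¹_H(X, μ I_H)` are integrable. -/
lemma integrable_inner_of_mem_calL1 (b : HilbertBasis ι ℂ H) {f : X → H →L[ℂ] H}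
    (hf : f ∈ calL1 b μ) (u v : H) : Integrable (fun x => ⟪u, f x v⟫_ℂ) μ := by
  induction hf using Submodule.span_induction with
  | zero => simp
  | add f g _ _ hf hg =>
    simp only [Pi.add_apply, add_apply, inner_add_right]
    exact hf.add hg
  | smul c f _ hf =>
    simp only [Pi.smul_apply, smul_apply, inner_smul_right]
    exact hf.const_mul c
  | mem f hf =>
    have hdiag (w : H) : Integrable
        (fun x => ⟪(ContinuousLinearMap.adjoint (f x) : H →ₗ[ℂ] H) w, w⟫_ℂ) μ := by
      simp only [ContinuousLinearMap.coe_coe, ContinuousLinearMap.adjoint_inner_left]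
      rcases eq_or_ne w 0 with rfl | hw
      · simp
      have h := hf.2.2 _ (isState_rankOne b (norm_smul_inv_norm (𝕜 := ℂ) hw))
      have h' := h.const_mul ((‖w‖ : ℂ) ^ 2)
      refine h'.congr (ae_of_all _ fun x => ?_)
      have : (‖w‖ : ℂ) ≠ 0 := by simpa using hw
      beta_reduce
      rw [slice_rankOne, (f x).map_smul, inner_smul_left, inner_smul_right, map_inv₀]
      simp only [Complex.coe_algebraMap, Complex.conj_ofReal]
      field_simp
    have hpol (x : X) := inner_map_polarization
      (ContinuousLinearMap.adjoint (f x) : H →ₗ[ℂ] H) v u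
    simp only [← ContinuousLinearMap.adjoint_inner_left]
    simp only [ContinuousLinearMap.coe_coe] at hpol hdiag
    simp only [hpol]
    exact ((((hdiag _).sub (hdiag _)).add ((hdiag _).const_mul _)).sub
      ((hdiag _).const_mul _)).div_const 4

end Coefficients

/-! ### Decreasing rearrangements -/

section Rearrangement

open Filter Topology

variable {X : Type*} [MeasurableSpace X] {μ : Measure X} [IsFiniteMeasure μ] {w : X → ℝ}

lemma distrib_antitone (μ : Measure X) [IsFiniteMeasure μ] (w : X → ℝ) :
    Antitone (distrib μ w) := fun _ _ h =>
  measureReal_mono fun _ hx => lt_of_le_of_lt h hx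

lemma distrib_le (μ : Measure X) [IsFiniteMeasure μ] (w : X → ℝ) (s : ℝ) :
    distrib μ w s ≤ μ.real univ :=
  measureReal_mono (subset_univ _)

/-- The distribution function is right continuous. -/
lemma exists_gt_lt_distrib {r s : ℝ} (h : r < distrib μ w s) :
    ∃ s', s < s' ∧ r < distrib μ w s' := by
  have hU : {x | s < w x} = ⋃ n : ℕ, {x | s + 1 / ((n : ℝ) + 1) < w x} := by
    ext x
    simp only [mem_ofPred_eq, mem_iUnion]
    refine ⟨fun hx => ?_, fun ⟨n, hn⟩ => ?_⟩
    · obtain ⟨n, hn⟩ := exists_nat_one_div_lt (sub_pos.2 hx)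
      exact ⟨n, by linarith⟩
    · have : 0 < 1 / ((n : ℝ) + 1) := Nat.one_div_pos_of_nat
      linarith
  have hmono : Monotone fun n : ℕ => {x | s + 1 / ((n : ℝ) + 1) < w x} := by
    intro m n hmn x hx
    rw [mem_ofPred_eq] at hx ⊢
    have : 1 / ((n : ℝ) + 1) ≤ 1 / ((m : ℝ) + 1) := Nat.one_div_le_one_div hmn
    linarith
  have hlim := (ENNReal.tendsto_toReal (measure_ne_top μ _)).comp
    (tendsto_measure_iUnion_atTop (μ := μ) hmono)
  rw [← hU] at hlim
  obtain ⟨n, hn⟩ := (hlim.eventually (lt_mem_nhds h)).exists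
  exact ⟨_, lt_add_of_pos_right s Nat.one_div_pos_of_nat, hn⟩

lemma exists_lt_distrib {r : ℝ} (h : r < μ.real univ) : ∃ s, r < distrib μ w s := by
  have hU : (univ : Set X) = ⋃ n : ℕ, {x | -(n : ℝ) < w x} := by
    refine (eq_univ_of_forall fun x => mem_iUnion.2 ?_).symm
    obtain ⟨n, hn⟩ := exists_nat_gt (-w x)
    exact ⟨n, by simp only [mem_ofPred_eq]; linarith⟩
  have hmono : Monotone fun n : ℕ => {x | -(n : ℝ) < w x} := by
    intro m n hmn x hx
    rw [mem_ofPred_eq] at hx ⊢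
    have : (m : ℝ) ≤ n := by exact_mod_cast hmn
    linarith
  have hlim := (ENNReal.tendsto_toReal (measure_ne_top μ _)).comp
    (tendsto_measure_iUnion_atTop (μ := μ) hmono)
  rw [← hU] at hlim
  obtain ⟨n, hn⟩ := (hlim.eventually (lt_mem_nhds h)).exists
  exact ⟨_, hn⟩

lemma nonempty_setOf_le_distrib {r : ℝ} (h : r < μ.real univ) :
    {s | r ≤ distrib μ w s}.Nonempty :=
  (exists_lt_distrib h).imp fun _ => le_of_lt

lemma bddAbove_setOf_le_distrib (hw : Integrable w μ) {r : ℝ} (hr : 0 < r) :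
    BddAbove {s | r ≤ distrib μ w s} := by
  refine ⟨(∫ x, |w x| ∂μ) / r, fun s (hs : r ≤ _) => ?_⟩
  rcases le_or_gt s 0 with h0 | h0
  · exact h0.trans (by positivity)
  rw [le_div_iff₀ hr]
  calc s * r ≤ s * μ.real {x | s ≤ |w x|} := by
        gcongr
        exact hs.trans (measureReal_mono fun x (hx : s < w x) => hx.le.trans (le_abs_self _))
    _ ≤ _ := mul_meas_ge_le_integral_of_nonneg (ae_of_all _ fun _ => abs_nonneg _) hw.abs s

lemma lt_rearrange (hw : Integrable w μ) {r s : ℝ} (hr : 0 < r) (h : r < distrib μ w s) :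
    s < rearrange μ w r := by
  obtain ⟨s', hs, hs'⟩ := exists_gt_lt_distrib h
  exact hs.trans_le (le_csSup (bddAbove_setOf_le_distrib hw hr) hs'.le)

lemma le_distrib_of_lt_rearrange {r s : ℝ} (hr : r < μ.real univ) (h : s < rearrange μ w r) :
    r ≤ distrib μ w s := by
  obtain ⟨s', hs', hlt⟩ := exists_lt_of_lt_csSup (nonempty_setOf_le_distrib hr) h
  exact le_trans hs' (distrib_antitone μ w hlt.le)

lemma rearrange_antitoneOn (hw : Integrable w μ) :
    AntitoneOn (rearrange μ w) (Ioo 0 (μ.real univ)) := fun _ hr _ ht hrt =>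
  csSup_le_csSup (bddAbove_setOf_le_distrib hw hr.1) (nonempty_setOf_le_distrib ht.2)
    fun _ hs => hrt.trans hs

/-- A function and its decreasing rearrangement are equimeasurable: under Lebesgue measure on
`(0, μ(X))` the rearrangement has the law of `w` under `μ`. -/
lemma identDistrib_rearrange (hw : Integrable w μ) :
    ProbabilityTheory.IdentDistrib (rearrange μ w) w
      (volume.restrict (Ioo 0 (μ.real univ))) μ := by
  have hm : AEMeasurable (rearrange μ w) (volume.restrict (Ioo 0 (μ.real univ))) :=
    aemeasurable_restrict_of_antitoneOn measurableSet_Ioo (rearrange_antitoneOn hw)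
  refine ⟨hm, hw.aemeasurable, ?_⟩
  have huniv : (Measure.map (rearrange μ w) (volume.restrict (Ioo 0 (μ.real univ)))) univ
      = (Measure.map w μ) univ := by
    rw [Measure.map_apply_of_aemeasurable hm .univ,
      Measure.map_apply_of_aemeasurable hw.aemeasurable .univ]
    simp
  have hIoi (s : ℝ) : (Measure.map (rearrange μ w) (volume.restrict (Ioo 0 (μ.real univ))))
      (Ioi s) = (Measure.map w μ) (Ioi s) := by
    rw [Measure.map_apply_of_aemeasurable hm measurableSet_Ioi,
      Measure.map_apply_of_aemeasurable hw.aemeasurable measurableSet_Ioi,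
      Measure.restrict_apply₀' measurableSet_Ioo.nullMeasurableSet]
    have hd : μ (w ⁻¹' Ioi s) = ENNReal.ofReal (distrib μ w s) := by
      rw [distrib, ofReal_measureReal]; rfl
    rw [hd]
    apply le_antisymm
    · calc _ ≤ volume (Ioc 0 (distrib μ w s)) := measure_mono fun r hr =>
            ⟨hr.2.1, le_distrib_of_lt_rearrange hr.2.2 hr.1⟩
        _ = _ := by simp
    · have hsub : Ioo 0 (distrib μ w s) ⊆ rearrange μ w ⁻¹' Ioi s ∩ Ioo 0 (μ.real univ) :=
        fun r hr => ⟨lt_rearrange hw hr.1 hr.2, hr.1, hr.2.trans_le (distrib_le μ w s)⟩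
      simpa using measure_mono (μ := volume) hsub
  refine Measure.ext_of_Iic _ _ fun s => ?_
  have := Measure.isFiniteMeasure_map μ w
  rw [← compl_Ioi, measure_compl measurableSet_Ioi (measure_ne_top _ _),
    measure_compl measurableSet_Ioi (measure_ne_top _ _), hIoi, huniv]

lemma integral_rearrange_univ (hw : Integrable w μ) :
    ∫ r in (0 : ℝ)..(μ.real univ), rearrange μ w r = ∫ x, w x ∂μ := by
  rw [intervalIntegral.integral_of_le measureReal_nonneg, integral_Ioc_eq_integral_Ioo]
  exact (identDistrib_rearrange hw).integral_eq

lemma integrableOn_rearrange (hw : Integrable w μ) :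
    IntegrableOn (rearrange μ w) (Ioo 0 (μ.real univ)) :=
  (identDistrib_rearrange hw).integrable_iff.2 hw

lemma integral_posPart_rearrange (hw : Integrable w μ) (c : ℝ) :
    ∫ r in Ioo 0 (μ.real univ), max (rearrange μ w r - c) 0 = ∫ x, max (w x - c) 0 ∂μ :=
  ((identDistrib_rearrange hw).comp (u := fun y => max (y - c) 0) (by fun_prop)).integral_eq

lemma integrableOn_posPart_rearrange (hw : Integrable w μ) (c : ℝ) :
    IntegrableOn (fun r => max (rearrange μ w r - c) 0) (Ioo 0 (μ.real univ)) :=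
  ((identDistrib_rearrange hw).comp (u := fun y => max (y - c) 0) (by fun_prop)).integrable_iff.2
    (hw.sub (integrable_const c)).pos_part

/-- One half of the variational formula
`∫₀ᵗ w↓ = min_c (t c + ∫ (w - c)⁺ dμ)`: every `c` gives an upper bound. -/
lemma integral_rearrange_le (hw : Integrable w μ) {t : ℝ} (ht : t ∈ Icc 0 (μ.real univ)) (c : ℝ) :
    ∫ r in (0 : ℝ)..t, rearrange μ w r ≤ t * c + ∫ x, max (w x - c) 0 ∂μ := by
  have hsub : Ioo 0 t ⊆ Ioo 0 (μ.real univ) := Ioo_subset_Ioo_right ht.2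
  have hi := (integrableOn_posPart_rearrange hw c)
  rw [intervalIntegral.integral_of_le ht.1, integral_Ioc_eq_integral_Ioo,
    ← integral_posPart_rearrange hw c]
  calc ∫ r in Ioo 0 t, rearrange μ w r
      ≤ ∫ r in Ioo 0 t, (c + max (rearrange μ w r - c) 0) := by
        refine integral_mono ((integrableOn_rearrange hw).mono_set hsub)
          ((integrable_const c).add (hi.mono_set hsub)) fun r => ?_
        have := le_max_left (rearrange μ w r - c) 0
        simp only; linarith
    _ = t * c + ∫ r in Ioo 0 t, max (rearrange μ w r - c) 0 := by
        rw [integral_add (integrable_const c) (hi.mono_set hsub)]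
        simp [ht.1]
    _ ≤ _ := by
        gcongr
        exact ae_of_all _ fun _ => le_max_right _ _

/-- The other half of the variational formula: `c = w↓(t)` attains the minimum. -/
lemma integral_rearrange_eq (hw : Integrable w μ) {t : ℝ} (ht : t ∈ Ioo 0 (μ.real univ)) :
    ∫ r in (0 : ℝ)..t, rearrange μ w r =
      t * rearrange μ w t + ∫ x, max (w x - rearrange μ w t) 0 ∂μ := by
  set c := rearrange μ w t with hc
  have hsub : Ioo 0 t ⊆ Ioo 0 (μ.real univ) := Ioo_subset_Ioo_right ht.2.le
  have hi := (integrableOn_posPart_rearrange hw c)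
  rw [intervalIntegral.integral_of_le ht.1.le, integral_Ioc_eq_integral_Ioo,
    ← integral_posPart_rearrange hw c]
  have hout : ∫ r in Ioo 0 t, max (rearrange μ w r - c) 0 =
      ∫ r in Ioo 0 (μ.real univ), max (rearrange μ w r - c) 0 := by
    symm
    refine setIntegral_eq_of_subset_of_forall_sdiff_eq_zero measurableSet_Ioo hsub fun r hr => ?_
    have htr : t ≤ r := not_lt.1 fun h => hr.2 ⟨hr.1.1, h⟩
    exact max_eq_right (sub_nonpos.2 (rearrange_antitoneOn hw ht hr.1 htr))
  have hin : ∫ r in Ioo 0 t, rearrange μ w r =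
      ∫ r in Ioo 0 t, (c + max (rearrange μ w r - c) 0) := by
    refine setIntegral_congr_fun measurableSet_Ioo fun r hr => ?_
    have := rearrange_antitoneOn hw (hsub hr) ht hr.2.le
    rw [max_eq_left (sub_nonneg.2 this)]
    ring
  rw [hin, integral_add (integrable_const c) (hi.mono_set hsub), hout]
  simp [ht.1.le]

/-- Domination of the integrals of all functions `(· - c)⁺`, together with equality of the
integrals, implies majorization. -/
lemma majorized_of_integral_posPart_le {u v : X → ℝ} (hu : Integrable u μ) (hv : Integrable v μ)
    (hle : ∀ c, ∫ x, max (u x - c) 0 ∂μ ≤ ∫ x, max (v x - c) 0 ∂μ)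
    (heq : ∫ x, u x ∂μ = ∫ x, v x ∂μ) : Majorized μ u v := by
  refine ⟨hu, hv, fun t ht => ?_, ?_⟩
  · rcases ht.1.eq_or_lt with rfl | h0
    · simp
    rcases ht.2.eq_or_lt with rfl | h1
    · rw [integral_rearrange_univ hu, integral_rearrange_univ hv, heq]
    rw [integral_rearrange_eq hv ⟨h0, h1⟩]
    exact (integral_rearrange_le hu ht _).trans (add_le_add_right (hle _) _)
  · rw [integral_rearrange_univ hu, integral_rearrange_univ hv, heq]

end Rearrangement

/-! ### Bistochastic operators -/

section Bistochastic

variable {X : Type*} [MeasurableSpace X] {μ : Measure X}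

/-- The element of the complex space `L¹` represented by a real integrable function. -/
noncomputable def ofRealL1 {w : X → ℝ} (hw : Integrable w μ) : Lp ℂ 1 μ :=
  hw.ofReal.toL1 (fun x => (w x : ℂ))

lemma coeFn_ofRealL1 {w : X → ℝ} (hw : Integrable w μ) :
    ofRealL1 hw =ᵐ[μ] fun x => (w x : ℂ) :=
  hw.ofReal.coeFn_toL1

variable [IsFiniteMeasure μ]

/-- Decomposition of a complex function into four positive parts, with the real part cut at the
level `c`. -/
lemma eq_ofRealL1_combination {h : Lp ℂ 1 μ} {c : ℝ}
    (h₁ : Integrable (fun x => max ((h x).re - c) 0) μ)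
    (h₂ : Integrable (fun x => max (c - (h x).re) 0) μ)
    (h₃ : Integrable (fun x => max (h x).im 0) μ)
    (h₄ : Integrable (fun x => max (-(h x).im) 0) μ) :
    h = ofRealL1 h₁ - ofRealL1 h₂ + (c : ℂ) • Lp.const 1 μ (1 : ℂ) +
      Complex.I • (ofRealL1 h₃ - ofRealL1 h₄) := by
  refine Lp.ext ?_
  filter_upwards [coeFn_ofRealL1 h₁, coeFn_ofRealL1 h₂, coeFn_ofRealL1 h₃, coeFn_ofRealL1 h₄,
    Lp.coeFn_add (ofRealL1 h₁ - ofRealL1 h₂ + (c : ℂ) • Lp.const 1 μ (1 : ℂ))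
      (Complex.I • (ofRealL1 h₃ - ofRealL1 h₄)),
    Lp.coeFn_add (ofRealL1 h₁ - ofRealL1 h₂) ((c : ℂ) • Lp.const 1 μ (1 : ℂ)),
    Lp.coeFn_sub (ofRealL1 h₁) (ofRealL1 h₂), Lp.coeFn_sub (ofRealL1 h₃) (ofRealL1 h₄),
    Lp.coeFn_smul (c : ℂ) (Lp.const 1 μ (1 : ℂ)), Lp.coeFn_const (p := 1) (μ := μ) (1 : ℂ),
    Lp.coeFn_smul Complex.I (ofRealL1 h₃ - ofRealL1 h₄)]
    with x e₁ e₂ e₃ e₄ a₁ a₂ a₃ a₄ a₅ a₆ a₇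
  rw [a₁, Pi.add_apply, a₂, Pi.add_apply, a₃, Pi.sub_apply, a₅, Pi.smul_apply, a₆, a₇,
    Pi.smul_apply, a₄, Pi.sub_apply, e₁, e₂, e₃, e₄]
  have hpos (y : ℝ) : max y 0 - max (-y) 0 = y := by
    rcases le_total y 0 with hy | hy
    · rw [max_eq_right hy, max_eq_left (neg_nonneg.2 hy)]; ring
    · rw [max_eq_left hy, max_eq_right (neg_nonpos.2 hy)]; ring
  have hre := hpos ((h x).re - c)
  rw [neg_sub] at hre
  apply Complex.ext
  · simp [hre]
  · simp [hpos]

namespace IsBistochastic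

variable {B : Lp ℂ 1 μ →ₗ[ℂ] Lp ℂ 1 μ} (hB : IsBistochastic μ B)
include hB

lemma ofRealL1_nonneg {w : X → ℝ} (hw : Integrable w μ) (h0 : ∀ x, 0 ≤ w x) :
    ∀ᵐ x ∂μ, 0 ≤ B (ofRealL1 hw) x := by
  refine hB.positive _ ?_
  filter_upwards [coeFn_ofRealL1 hw] with x hx
  rw [hx]
  exact Complex.zero_le_real.2 (h0 x)

lemma integral_re_ofRealL1 {w : X → ℝ} (hw : Integrable w μ) :
    ∫ x, (B (ofRealL1 hw) x).re ∂μ = ∫ x, w x ∂μ := by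
  have h : ∫ x, (B (ofRealL1 hw) x).re ∂μ = (∫ x, B (ofRealL1 hw) x ∂μ).re :=
    Complex.reCLM.integral_comp_comm (L1.integrable_coeFn _)
  rw [h, hB.integral_eq, integral_congr_ae (coeFn_ofRealL1 hw), integral_complex_ofReal,
    Complex.ofReal_re]

lemma norm_map_ofRealL1 {w : X → ℝ} (hw : Integrable w μ) (h0 : ∀ x, 0 ≤ w x) :
    ‖B (ofRealL1 hw)‖ = ∫ x, w x ∂μ := by
  rw [L1.norm_eq_integral_norm, ← hB.integral_re_ofRealL1 hw]
  refine integral_congr_ae ?_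
  filter_upwards [hB.ofRealL1_nonneg hw h0] with x hx
  exact (Complex.re_eq_norm.2 hx).symm

/-- A bistochastic operator is bounded: it is isometric on positive functions. The constant `4`
counts the positive parts of a complex function. -/
lemma norm_map_le (h : Lp ℂ 1 μ) : ‖B h‖ ≤ 4 * ‖h‖ := by
  have hi := L1.integrable_coeFn h
  have hre : Integrable (fun x => (h x).re) μ := hi.re
  have him : Integrable (fun x => (h x).im) μ := hi.im
  have h₁ := (hre.sub (integrable_const 0)).pos_part
  have h₂ := ((integrable_const 0).sub hre).pos_part
  have h₃ := him.pos_part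
  have h₄ := him.neg.pos_part
  have hle {w : X → ℝ} (hw : Integrable w μ) (h0 : ∀ x, 0 ≤ w x) (hwh : ∀ x, w x ≤ ‖h x‖) :
      ‖B (ofRealL1 hw)‖ ≤ ‖h‖ := by
    rw [hB.norm_map_ofRealL1 hw h0, L1.norm_eq_integral_norm]
    exact integral_mono hw hi.norm hwh
  have hdec := eq_ofRealL1_combination (h := h) h₁ h₂ h₃ h₄
  have e₁ := hle h₁ (fun _ => le_max_right _ _) fun x => max_le
    (by simpa using Complex.re_le_norm (h x)) (norm_nonneg _)
  have e₂ := hle h₂ (fun _ => le_max_right _ _) fun x => max_le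
    (by simpa using (neg_le_abs _).trans (Complex.abs_re_le_norm (h x))) (norm_nonneg _)
  have e₃ := hle h₃ (fun _ => le_max_right _ _) fun x => max_le
    (Complex.im_le_norm (h x)) (norm_nonneg _)
  have e₄ := hle h₄ (fun _ => le_max_right _ _) fun x => max_le
    ((neg_le_abs _).trans (Complex.abs_im_le_norm (h x))) (norm_nonneg _)
  have hBdec : B h = B (ofRealL1 h₁) - B (ofRealL1 h₂) +
      Complex.I • (B (ofRealL1 h₃) - B (ofRealL1 h₄)) := by
    conv_lhs => rw [hdec]
    simp
  rw [hBdec]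
  refine (norm_add_le _ _).trans ?_
  rw [norm_smul, Complex.norm_I, one_mul]
  linarith [norm_sub_le (B (ofRealL1 h₁)) (B (ofRealL1 h₂)),
    norm_sub_le (B (ofRealL1 h₃)) (B (ofRealL1 h₄))]

/-- Jensen's inequality for the functions `(· - c)⁺`: positivity of `B` and `B 1 = 1` give
`(re (B h) - c)⁺ ≤ B (re h - c)⁺`, and the right-hand side has the same integral as
`(re h - c)⁺`. -/
lemma integral_posPart_re_le (h : Lp ℂ 1 μ) (c : ℝ) :
    ∫ x, max ((B h x).re - c) 0 ∂μ ≤ ∫ x, max ((h x).re - c) 0 ∂μ := by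
  have hi := L1.integrable_coeFn h
  have hre : Integrable (fun x => (h x).re) μ := hi.re
  have him : Integrable (fun x => (h x).im) μ := hi.im
  have h₁ := (hre.sub (integrable_const c)).pos_part
  have h₂ := ((integrable_const c).sub hre).pos_part
  have h₃ := him.pos_part
  have h₄ := him.neg.pos_part
  have hdec := eq_ofRealL1_combination (h := h) h₁ h₂ h₃ h₄
  have hBdec : B h = B (ofRealL1 h₁) - B (ofRealL1 h₂) + (c : ℂ) • Lp.const 1 μ (1 : ℂ) +
      Complex.I • (B (ofRealL1 h₃) - B (ofRealL1 h₄)) := by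
    conv_lhs => rw [hdec]
    simp only [map_add, map_sub, map_smul, hB.map_one]
  refine le_of_le_of_eq (integral_mono_ae ?_ ?_ ?_) (hB.integral_re_ofRealL1 h₁)
  · exact ((L1.integrable_coeFn (B h)).re.sub (integrable_const c)).pos_part
  · exact (L1.integrable_coeFn (B (ofRealL1 h₁))).re
  rw [hBdec]
  filter_upwards [hB.ofRealL1_nonneg h₁ fun _ => le_max_right _ _,
    hB.ofRealL1_nonneg h₂ fun _ => le_max_right _ _,
    hB.ofRealL1_nonneg h₃ fun _ => le_max_right _ _,
    hB.ofRealL1_nonneg h₄ fun _ => le_max_right _ _,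
    Lp.coeFn_add (B (ofRealL1 h₁) - B (ofRealL1 h₂) + (c : ℂ) • Lp.const 1 μ (1 : ℂ))
      (Complex.I • (B (ofRealL1 h₃) - B (ofRealL1 h₄))),
    Lp.coeFn_add (B (ofRealL1 h₁) - B (ofRealL1 h₂)) ((c : ℂ) • Lp.const 1 μ (1 : ℂ)),
    Lp.coeFn_sub (B (ofRealL1 h₁)) (B (ofRealL1 h₂)),
    Lp.coeFn_sub (B (ofRealL1 h₃)) (B (ofRealL1 h₄)),
    Lp.coeFn_smul (c : ℂ) (Lp.const 1 μ (1 : ℂ)), Lp.coeFn_const (p := 1) (μ := μ) (1 : ℂ),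
    Lp.coeFn_smul Complex.I (B (ofRealL1 h₃) - B (ofRealL1 h₄))]
    with x e₁ e₂ e₃ e₄ a₁ a₂ a₃ a₄ a₅ a₆ a₇
  refine max_le ?_ (Complex.nonneg_iff.1 e₁).1
  rw [a₁, Pi.add_apply, a₂, Pi.add_apply, a₃, Pi.sub_apply, a₅, Pi.smul_apply, a₆, a₇,
    Pi.smul_apply, a₄, Pi.sub_apply]
  have i₂ := (Complex.nonneg_iff.1 e₂).1
  have i₃ := (Complex.nonneg_iff.1 e₃).2
  have i₄ := (Complex.nonneg_iff.1 e₄).2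
  simp [← i₃, ← i₄]
  exact i₂

/-- The Hardy–Littlewood–Pólya direction of classical majorization theory: the real part of the
image of a function under a bistochastic operator is majorized by its real part. -/
lemma majorized_re {p q : X → ℂ} {P Q : Lp ℂ 1 μ} (hP : P =ᵐ[μ] p) (hQ : Q =ᵐ[μ] q)
    (hBQ : B Q = P) : Majorized μ (fun x => (p x).re) (fun x => (q x).re) := by
  have hp : Integrable p μ := (L1.integrable_coeFn P).congr hP
  have hq : Integrable q μ := (L1.integrable_coeFn Q).congr hQ
  refine majorized_of_integral_posPart_le hp.re hq.re (fun c => ?_) ?_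
  · have hP' : (fun x => max ((p x).re - c) 0) =ᵐ[μ] fun x => max ((B Q x).re - c) 0 := by
      filter_upwards [hP] with x hx
      rw [hBQ, hx]
    have hQ' : (fun x => max ((q x).re - c) 0) =ᵐ[μ] fun x => max ((Q x).re - c) 0 := by
      filter_upwards [hQ] with x hx
      rw [hx]
    rw [integral_congr_ae hP', integral_congr_ae hQ']
    exact hB.integral_posPart_re_le Q c
  · have h := hB.integral_eq Q
    rw [hBQ, integral_congr_ae hP, integral_congr_ae hQ] at h
    have hpre : ∫ x, (p x).re ∂μ = (∫ x, p x ∂μ).re := Complex.reCLM.integral_comp_comm hp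
    have hqre : ∫ x, (q x).re ∂μ = (∫ x, q x ∂μ).re := Complex.reCLM.integral_comp_comm hq
    rw [hpre, hqre, h]

end IsBistochastic

end Bistochastic

/-! ### Bistochastic operators and the slices of operator-valued functions -/

section Slices

variable {X : Type*} [MeasurableSpace X] {μ : Measure X} [IsFiniteMeasure μ]
variable {ι : Type*} {H : Type*} [NormedAddCommGroup H] [InnerProductSpace ℂ H]

/-- A bistochastic operator that maps the entries of `g` to those of `f` maps all matrix
coefficients of `g` to those of `f`, by sesquilinearity and continuity. -/
lemma map_coefficient_eq (b : HilbertBasis ι ℂ H) {f g : X → H →L[ℂ] H}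
    {B : Lp ℂ 1 μ →ₗ[ℂ] Lp ℂ 1 μ} (hB : IsBistochastic μ B) (hBgf : EntrywiseMaps b μ B g f)
    {hf : ∀ u v, Integrable (fun x => ⟪u, f x v⟫_ℂ) μ}
    {hg : ∀ u v, Integrable (fun x => ⟪u, g x v⟫_ℂ) μ}
    {Φf Φg : H →L⋆[ℂ] H →L[ℂ] Lp ℂ 1 μ}
    (hΦf : ∀ u v, Φf u v = (hf u v).toL1 (fun x => ⟪u, f x v⟫_ℂ))
    (hΦg : ∀ u v, Φg u v = (hg u v).toL1 (fun x => ⟪u, g x v⟫_ℂ)) (u v : H) :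
    B (Φg u v) = Φf u v := by
  let B' : Lp ℂ 1 μ →L[ℂ] Lp ℂ 1 μ := B.mkContinuous 4 hB.norm_map_le
  have hdense : Dense (Submodule.span ℂ (range b) : Set H) :=
    Submodule.dense_iff_topologicalClosure_eq_top.2 b.dense_span
  have hright (i : ι) : B' ∘L Φg (b i) = Φf (b i) := by
    refine ContinuousLinearMap.ext_on hdense ?_
    rintro _ ⟨j, rfl⟩
    obtain ⟨hg', hf', h⟩ := hBgf i j
    change B (Φg (b i) (b j)) = Φf (b i) (b j)
    rw [hΦg, hΦf]
    exact h
  have hleft : (ContinuousLinearMap.compL ℂ H _ _ B').comp Φg = Φf := by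
    refine ContinuousLinearMap.ext_on hdense ?_
    rintro _ ⟨i, rfl⟩
    exact hright i
  exact congr($hleft u v)

variable [CompleteSpace H]

/-- If a bistochastic operator maps `g` to `f` entrywise, then `f_t ≺ g_t` for every self-adjoint
trace-class operator `t`: the operator maps `g_t` to `f_t`. -/
lemma Prec.precT [TopologicalSpace.SeparableSpace H] (b : HilbertBasis ι ℂ H)
    {f g : X → H →L[ℂ] H} (hf : f ∈ calL1 b μ) (hg : g ∈ calL1 b μ) (h : Prec b μ f g) :
    PrecT b μ f g := by
  obtain ⟨B, hB, hBgf⟩ := h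
  intro t ht hsa
  have hf' := integrable_inner_of_mem_calL1 b hf
  have hg' := integrable_inner_of_mem_calL1 b hg
  obtain ⟨Φf, hΦf⟩ := exists_sesquilinear_toL1 f hf'
  obtain ⟨Φg, hΦg⟩ := exists_sesquilinear_toL1 g hg'
  obtain ⟨S, R, hS, hSs, hR, hRs, rfl⟩ := exists_sq_sub_sq b ht hsa
  have hslice (k : X → H →L[ℂ] H) (x : X) :
      slice b (S * S - R * R) k x = slice b (S * S) k x - slice b (R * R) k x := by
    obtain ⟨σ, hσ, -⟩ := hasSum_trace_sq_mul b hS hSs (k x)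
    obtain ⟨ρ, hρ, -⟩ := hasSum_trace_sq_mul b hR hRs (k x)
    simp only [slice, trace]
    rw [hσ.tsum_eq, hρ.tsum_eq, ← (hσ.sub hρ).tsum_eq]
    simp only [sub_mul, sub_apply, inner_sub_right]
  have hmap {T : H →L[ℂ] H} {P Q : Lp ℂ 1 μ}
      (hP : HasSum (fun i => Φf (T (b i)) (T (b i))) P)
      (hQ : HasSum (fun i => Φg (T (b i)) (T (b i))) Q) : B Q = P := by
    have hBQ := (B.mkContinuous 4 hB.norm_map_le).hasSum hQ
    simp only [LinearMap.mkContinuous_apply, map_coefficient_eq b hB hBgf hΦf hΦg] at hBQ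
    exact hBQ.unique hP
  obtain ⟨PS, hPS, hPS'⟩ := exists_hasSum_slice_sq b hΦf hS hSs
  obtain ⟨PR, hPR, hPR'⟩ := exists_hasSum_slice_sq b hΦf hR hRs
  obtain ⟨QS, hQS, hQS'⟩ := exists_hasSum_slice_sq b hΦg hS hSs
  obtain ⟨QR, hQR, hQR'⟩ := exists_hasSum_slice_sq b hΦg hR hRs
  refine hB.majorized_re (P := PS - PR) (Q := QS - QR) ?_ ?_ ?_
  · filter_upwards [Lp.coeFn_sub PS PR, hPS', hPR'] with x h₁ h₂ h₃
    rw [h₁, Pi.sub_apply, h₂, h₃, hslice]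
  · filter_upwards [Lp.coeFn_sub QS QR, hQS', hQR'] with x h₁ h₂ h₃
    rw [h₁, Pi.sub_apply, h₂, h₃, hslice]
  · rw [map_sub, hmap hPS hQS, hmap hPR hQR]

omit [IsFiniteMeasure μ] in
lemma PrecT.precS (b : HilbertBasis ι ℂ H) {f g : X → H →L[ℂ] H} (h : PrecT b μ f g) :
    PrecS b μ f g :=
  fun s hs => h s hs.1 hs.2.1.isSelfAdjoint

end Slices

end QRV

theorem mainTheorem5 {ι : Type*} {H : Type*} [NormedAddCommGroup H] [InnerProductSpace ℂ H]
    [CompleteSpace H] [TopologicalSpace.SeparableSpace H] (b : HilbertBasis ι ℂ H)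
    (μ : Measure unitInterval) [IsFiniteMeasure μ]
    (f g : unitInterval → H →L[ℂ] H)
    (hf : f ∈ QRV.calL1 b μ) (hg : g ∈ QRV.calL1 b μ)
    (hfsa : ∀ᵐ x ∂μ, IsSelfAdjoint (f x)) (hgsa : ∀ᵐ x ∂μ, IsSelfAdjoint (g x)) :
    (QRV.Prec b μ f g → QRV.PrecT b μ f g) ∧ (QRV.PrecT b μ f g → QRV.PrecS b μ f g) :=
  ⟨QRV.Prec.precT b hf hg, QRV.PrecT.precS b⟩
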